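/- Let $\mathbb N=\{1,2,3,\dots\}$. A rotational lattice is an algebra $\langle L;\vee,\wedge,g\rangle$ such that $\langle L;\vee,\wedge\rangle$ is a nonempty lattice, $g$ is an automorphism of this lattice, and $g^n=\mathrm{id}_L$ for some $n\in\mathbb N$; it is distributive if the lattice $\langle L;\vee,\wedge\rangle$ is distributive. Homomorphisms, subalgebras, congruences, products and varieties are those of algebras with the operations $\vee,\wedge,g$; simple algebras and subdirectly irreducible algebras have, by convention, at least two elements. A variety of distributive rotational lattices is a variety (a class of algebras with two binary operations and one unary operation, closed under homomorphic images, subalgebras and arbitrary direct products) all of whose members are distributive rotational lattices. For $n\in\mathbb N$, let $B_n$ denote the $n$-dimensional rotational cube: the Boolean lattice with $n$ atoms $a_0,\dots,a_{n-1}$ and $2^n$ elements, together with the lattice automorphism $g$ determined by $g(a_i)=a_{i+1}$, with subscripts modulo $n$. For a set $X\subseteq\mathbb N$, let $\mathbf V(X)$ be the variety generated by $\{B_n:n\in X\}$. Let $\mathcal O$ be the set of all finite (possibly empty) subsets $X$ of $\mathbb N$ such that $x\in X$, $y\in\mathbb N$ and $y\mid x$ imply $y\in X$. (a) Up to isomorphism,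 the subdirectly irreducible distributive rotational lattices are exactly the rotational cubes $B_n$, $n\in\mathbb N$. Moreover, each $B_n$ is simple. (b) The varieties of distributive rotational lattices are exactly the classes $\mathbf V(X)$ with $X\in\mathcal O$. For $X,Y\in\mathcal O$, we have $\mathbf V(X)\subseteq\mathbf V(Y)$ if and only if $X\subseteq Y$. (c) For each $n\in\mathbb N$, the class of all distributive rotational lattices satisfying the identity $g^n(x)\approx x$ equals $\mathbf V(\{d\in\mathbb N: d\mid n\})$. -/

import Mathlib

universe u

/-- An algebra of type `(2, 2, 1)`: a nonempty set with two binary operations `sup`, `inf`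
and one unary operation `rot`; no identities are assumed. -/
structure RotAlgebra : Type (u + 1) where
  carrier : Type u
  nonempty : Nonempty carrier
  sup : carrier → carrier → carrier
  inf : carrier → carrier → carrier
  rot : carrier → carrier

namespace RotAlgebra

instance : CoeSort RotAlgebra.{u} (Type u) := ⟨RotAlgebra.carrier⟩

instance (A : RotAlgebra.{u}) : Nonempty A := A.nonempty

/-- `A` is a rotational lattice: `sup` and `inf` are the join and the meet of a lattice, and `rot`
is an automorphism of this lattice with `rot ^ n = id` for some `n ≥ 1`. -/
def IsRotationalLattice (A : RotAlgebra.{u}) : Prop :=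
  ∃ (_ : Lattice A) (σ : A ≃o A),
    (∀ x y : A, A.sup x y = x ⊔ y) ∧
    (∀ x y : A, A.inf x y = x ⊓ y) ∧
    (∀ x : A, A.rot x = σ x) ∧
    ∃ n : ℕ+, ∀ x : A, A.rot^[n] x = x

/-- `A` is a distributive rotational lattice. -/
def IsDistributiveRotationalLattice (A : RotAlgebra.{u}) : Prop :=
  A.IsRotationalLattice ∧
    ∀ x y z : A, A.inf x (A.sup y z) = A.sup (A.inf x y) (A.inf x z)

/-- Homomorphisms of algebras. -/
structure IsHom {A B : RotAlgebra.{u}} (f : A → B) : Prop where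
  map_sup : ∀ x y, f (A.sup x y) = B.sup (f x) (f y)
  map_inf : ∀ x y, f (A.inf x y) = B.inf (f x) (f y)
  map_rot : ∀ x, f (A.rot x) = B.rot (f x)

/-- `A` and `B` are isomorphic. -/
def Isomorphic (A B : RotAlgebra.{u}) : Prop :=
  ∃ f : A → B, IsHom f ∧ Function.Bijective f

/-- The direct product of a family of algebras, with componentwise operations. -/
def pi {ι : Type u} (A : ι → RotAlgebra.{u}) : RotAlgebra.{u} where
  carrier := ∀ i, A i
  nonempty := inferInstance
  sup x y := fun i => (A i).sup (x i) (y i)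
  inf x y := fun i => (A i).inf (x i) (y i)
  rot x := fun i => (A i).rot (x i)

/-- The equivalence relation `θ` is a congruence of `A`. -/
structure IsCongruence (A : RotAlgebra.{u}) (θ : Setoid A) : Prop where
  sup : ∀ {w x y z : A}, θ w x → θ y z → θ (A.sup w y) (A.sup x z)
  inf : ∀ {w x y z : A}, θ w x → θ y z → θ (A.inf w y) (A.inf x z)
  rot : ∀ {x y : A}, θ x y → θ (A.rot x) (A.rot y)

/-- `A` is simple: it is not a singleton, and its only congruences are the equality relation and
the full relation. -/
def IsSimple (A : RotAlgebra.{u}) : Prop :=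
  Nontrivial A ∧ ∀ θ : Setoid A, A.IsCongruence θ → θ = ⊥ ∨ θ = ⊤

/-- `f` is a subdirect embedding of `A` into the product of the algebras `B i`. -/
structure IsSubdirectEmbedding {A : RotAlgebra.{u}} {ι : Type u} {B : ι → RotAlgebra.{u}}
    (f : A → pi B) : Prop where
  hom : IsHom f
  injective : Function.Injective f
  surjective : ∀ i, Function.Surjective fun x : A => f x i

/-- `A` is subdirectly irreducible: it is not a singleton, and for each subdirect embedding of `A`
into a product, the composite with one of the projections is an isomorphism. -/
def IsSubdirectlyIrreducible (A : RotAlgebra.{u}) : Prop :=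
  Nontrivial A ∧
    ∀ (ι : Type u) (B : ι → RotAlgebra.{u}) (f : A → pi B), IsSubdirectEmbedding f →
      ∃ i, IsHom (A := A) (B := B i) (fun x => f x i) ∧ Function.Bijective fun x : A => f x i

/-- The `n`-dimensional rotational cube: the boolean lattice of all subsets of `ℤ/nℤ`, whose atoms
are the singletons `{i}`, with the automorphism that sends the atom `{i}` to `{i + 1}`. -/
def cube (n : ℕ+) : RotAlgebra.{u} where
  carrier := ULift.{u} (Set (ZMod n))
  nonempty := inferInstance
  sup S T := ⟨S.down ∪ T.down⟩
  inf S T := ⟨S.down ∩ T.down⟩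
  rot S := ⟨(fun i => i + 1) '' S.down⟩

/-- A variety: a class of algebras of type `(2, 2, 1)` that is closed under homomorphic images,
(isomorphic copies of) subalgebras, and direct products, the empty product included. -/
structure IsVariety (W : Set RotAlgebra.{u}) : Prop where
  image : ∀ {A B : RotAlgebra.{u}} (f : A → B), IsHom f → Function.Surjective f → A ∈ W → B ∈ W
  sub : ∀ {A B : RotAlgebra.{u}} (f : B → A), IsHom f → Function.Injective f → A ∈ W → B ∈ W
  pi : ∀ {ι : Type u} (A : ι → RotAlgebra.{u}), (∀ i, A i ∈ W) → pi A ∈ W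

/-- The variety generated by a class `K` of algebras: the smallest variety that includes `K`. -/
def generatedVariety (K : Set RotAlgebra.{u}) : Set RotAlgebra.{u} :=
  {A | ∀ W : Set RotAlgebra.{u}, IsVariety W → K ⊆ W → A ∈ W}

/-- The variety generated by the cubes `cube n`, `n ∈ X`. -/
def cubeVariety (X : Set ℕ+) : Set RotAlgebra.{u} :=
  generatedVariety (cube '' X)

/-- `X` is a finite order ideal of the positive integers ordered by divisibility
(the empty set is allowed). -/
def IsFiniteDivisorIdeal (X : Set ℕ+) : Prop :=
  X.Finite ∧ ∀ x y : ℕ+, x ∈ X → y ∣ x → y ∈ X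

end RotAlgebra

/-! Everything rests on one representation: a distributive rotational lattice is a subdirect product
of cubes. Prime filters separate points. Since `g` has finite order, the shifts of a prime filter
form a finite cycle of some length `d`, and distinct shifts are incomparable (`exists_period`).
Recording which shifts contain `x` therefore gives a homomorphism onto the whole of `cube d`
(`exists_surjective_hom_cube`, via `mem_of_separating`). So a subdirectly irreducible member is a
cube; conversely cubes are simple, hence subdirectly irreducible.

It follows that a variety is determined by the dimensions of its cubes. These dimensions are closed
under divisors, because `cube d` embeds in `cube n` when `d ∣ n`, and they are finite in number,
because a product argument bounds the exponent of the variety. Distinct ideals give distinct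
varieties because the identity `z ≤ ⋁ y ∈ Y, g^y z` holds in `cube y` for `y ∈ Y`, but in `cube x`
only if `x` divides some member of `Y`. -/

namespace RotAlgebra

/-! ### Homomorphisms and varieties -/

theorem IsHom.iterate_rot {A B : RotAlgebra.{u}} {f : A → B} (hf : IsHom f) (k : ℕ) (x : A) :
    f (A.rot^[k] x) = B.rot^[k] (f x) :=
  Function.Semiconj.iterate_right (f := f) hf.map_rot k x

theorem isHom_pi_apply {ι : Type u} (A : ι → RotAlgebra.{u}) (i : ι) :
    IsHom (A := pi A) (B := A i) fun x => x i :=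
  ⟨fun _ _ => rfl, fun _ _ => rfl, fun _ => rfl⟩

theorem IsHom.comp {A B C : RotAlgebra.{u}} {g : B → C} {f : A → B} (hg : IsHom g)
    (hf : IsHom f) : IsHom (g ∘ f) :=
  ⟨fun x y => by simp [hf.map_sup, hg.map_sup], fun x y => by simp [hf.map_inf, hg.map_inf],
    fun x => by simp [hf.map_rot, hg.map_rot]⟩

theorem pi_iterate_rot {ι : Type u} (A : ι → RotAlgebra.{u}) (k : ℕ) (x : pi A) (i : ι) :
    ((pi A).rot^[k] x) i = (A i).rot^[k] (x i) :=
  (isHom_pi_apply A i).iterate_rot k x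

/-- A ternary operation defined on all algebras and preserved by all homomorphisms. -/
def IsNatural (t : ∀ A : RotAlgebra.{u}, A → A → A → A) : Prop :=
  ∀ {A B : RotAlgebra.{u}} (f : A → B), IsHom f →
    ∀ x y z, f (t A x y z) = t B (f x) (f y) (f z)

/-- The easy half of Birkhoff's theorem, with natural operations in place of terms. Three variables
suffice for every identity used below; shorter identities carry dummy variables. -/
theorem isVariety_setOf_eq {s t : ∀ A : RotAlgebra.{u}, A → A → A → A} (hs : IsNatural s)
    (ht : IsNatural t) : IsVariety {A : RotAlgebra.{u} | ∀ x y z : A, s A x y z = t A x y z} where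
  image {A B} f hf hsurj hA x y z := by
    obtain ⟨x, rfl⟩ := hsurj x
    obtain ⟨y, rfl⟩ := hsurj y
    obtain ⟨z, rfl⟩ := hsurj z
    rw [← hs f hf, ← ht f hf, hA x y z]
  sub {A B} f hf hinj hA x y z := hinj (by rw [hs f hf, ht f hf, hA])
  pi {ι} A hA x y z := by
    funext i
    exact (hs _ (isHom_pi_apply A i) x y z).trans
      ((hA i _ _ _).trans (ht _ (isHom_pi_apply A i) x y z).symm)

theorem IsVariety.inter {V W : Set RotAlgebra.{u}} (hV : IsVariety V) (hW : IsVariety W) :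
    IsVariety (V ∩ W) where
  image f hf hs hA := ⟨hV.image f hf hs hA.1, hW.image f hf hs hA.2⟩
  sub f hf hs hA := ⟨hV.sub f hf hs hA.1, hW.sub f hf hs hA.2⟩
  pi A hA := ⟨hV.pi A fun i => (hA i).1, hW.pi A fun i => (hA i).2⟩

theorem isVariety_subsingleton : IsVariety {A : RotAlgebra.{u} | Subsingleton A} where
  image f _ hs hA := by
    have : Subsingleton _ := hA
    exact hs.subsingleton
  sub f _ hi hA := by
    have : Subsingleton _ := hA
    exact hi.subsingleton
  pi A hA := by
    have : ∀ i, Subsingleton (A i) := hA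
    exact ⟨fun x y => funext fun i => Subsingleton.elim _ _⟩

theorem isVariety_generatedVariety (K : Set RotAlgebra.{u}) : IsVariety (generatedVariety K) where
  image f hf hs hA W hW hK := hW.image f hf hs (hA W hW hK)
  sub f hf hs hA W hW hK := hW.sub f hf hs (hA W hW hK)
  pi A hA W hW hK := hW.pi A fun i => hA i W hW hK

theorem cube_mem_cubeVariety {X : Set ℕ+} {n : ℕ+} (hn : n ∈ X) :
    cube.{u} n ∈ cubeVariety X :=
  fun _ _ hK => hK ⟨n, hn, rfl⟩

theorem cubeVariety_subset {X : Set ℕ+} {W : Set RotAlgebra.{u}} (hW : IsVariety W)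
    (h : ∀ n ∈ X, cube n ∈ W) : cubeVariety X ⊆ W := fun A hA =>
  hA W hW (by rintro _ ⟨n, hn, rfl⟩; exact h n hn)

/-! ### Distributive rotational lattices of bounded exponent -/

/-- The identities of distributive lattices with an automorphism of order dividing `n`. -/
structure SatisfiesIdentities (A : RotAlgebra.{u}) (n : ℕ) : Prop where
  sup_comm : ∀ x y : A, A.sup x y = A.sup y x
  sup_assoc : ∀ x y z : A, A.sup (A.sup x y) z = A.sup x (A.sup y z)
  inf_comm : ∀ x y : A, A.inf x y = A.inf y x
  inf_assoc : ∀ x y z : A, A.inf (A.inf x y) z = A.inf x (A.inf y z)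
  sup_inf_self : ∀ x y : A, A.sup x (A.inf x y) = x
  inf_sup_self : ∀ x y : A, A.inf x (A.sup x y) = x
  inf_sup_left : ∀ x y z : A, A.inf x (A.sup y z) = A.sup (A.inf x y) (A.inf x z)
  rot_sup : ∀ x y : A, A.rot (A.sup x y) = A.sup (A.rot x) (A.rot y)
  rot_inf : ∀ x y : A, A.rot (A.inf x y) = A.inf (A.rot x) (A.rot y)
  iterate_rot : ∀ x : A, A.rot^[n] x = x

theorem isVariety_satisfiesIdentities (n : ℕ) :
    IsVariety {A : RotAlgebra.{u} | A.SatisfiesIdentities n} := by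
  have h : {A : RotAlgebra.{u} | A.SatisfiesIdentities n} =
      {A : RotAlgebra.{u} | ∀ x y _z : A, A.sup x y = A.sup y x} ∩
      ({A : RotAlgebra.{u} | ∀ x y z : A, A.sup (A.sup x y) z = A.sup x (A.sup y z)} ∩
      ({A : RotAlgebra.{u} | ∀ x y _z : A, A.inf x y = A.inf y x} ∩
      ({A : RotAlgebra.{u} | ∀ x y z : A, A.inf (A.inf x y) z = A.inf x (A.inf y z)} ∩
      ({A : RotAlgebra.{u} | ∀ x y _z : A, A.sup x (A.inf x y) = x} ∩
      ({A : RotAlgebra.{u} | ∀ x y _z : A, A.inf x (A.sup x y) = x} ∩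
      ({A : RotAlgebra.{u} | ∀ x y z : A, A.inf x (A.sup y z) = A.sup (A.inf x y) (A.inf x z)} ∩
      ({A : RotAlgebra.{u} | ∀ x y _z : A, A.rot (A.sup x y) = A.sup (A.rot x) (A.rot y)} ∩
      ({A : RotAlgebra.{u} | ∀ x y _z : A, A.rot (A.inf x y) = A.inf (A.rot x) (A.rot y)} ∩
      {A : RotAlgebra.{u} | ∀ x _y _z : A, A.rot^[n] x = x})))))))) := by
    ext A
    constructor
    · intro h
      exact ⟨fun x y _ => h.1 x y, h.2, fun x y _ => h.3 x y, h.4, fun x y _ => h.5 x y,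
        fun x y _ => h.6 x y, h.7, fun x y _ => h.8 x y, fun x y _ => h.9 x y,
        fun x _ _ => h.10 x⟩
    · rintro ⟨h1, h2, h3, h4, h5, h6, h7, h8, h9, h10⟩
      exact ⟨fun x y => h1 x y x, h2, fun x y => h3 x y x, h4, fun x y => h5 x y x,
        fun x y => h6 x y x, h7, fun x y => h8 x y x, fun x y => h9 x y x, fun x => h10 x x x⟩
  rw [h]
  refine .inter ?_ <| .inter ?_ <| .inter ?_ <| .inter ?_ <| .inter ?_ <| .inter ?_ <|
    .inter ?_ <| .inter ?_ <| .inter ?_ ?_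
  all_goals
    refine isVariety_setOf_eq ?_ ?_ <;> intro A B f hf x y z <;>
      simp only [hf.map_sup, hf.map_inf, hf.map_rot, hf.iterate_rot]

/-- The distributive lattice underlying an algebra that satisfies the identities. -/
@[reducible]
def SatisfiesIdentities.distribLattice {A : RotAlgebra.{u}} {n : ℕ}
    (h : A.SatisfiesIdentities n) : DistribLattice A :=
  letI : Max A := ⟨A.sup⟩
  letI : Min A := ⟨A.inf⟩
  letI := Lattice.mk' (α := A) h.sup_comm h.sup_assoc h.inf_comm h.inf_assoc h.sup_inf_self
    h.inf_sup_self
  DistribLattice.ofInfSupLe fun x y z => (h.inf_sup_left x y z).le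

/-- Bijectivity of the rotation is a consequence of the identities: since `n ≥ 1`, its inverse is
`rot^[n - 1]`. -/
theorem SatisfiesIdentities.isDistributiveRotationalLattice {A : RotAlgebra.{u}} {n : ℕ+}
    (h : A.SatisfiesIdentities n) : A.IsDistributiveRotationalLattice := by
  have hn : (n : ℕ) - 1 + 1 = n := Nat.sub_add_cancel n.pos
  let e : A ≃ A := ⟨A.rot, A.rot^[n - 1],
    fun x => by rw [← Function.iterate_succ_apply, Nat.succ_eq_add_one, hn, h.iterate_rot],
    fun x => by rw [← Function.iterate_succ_apply' A.rot, Nat.succ_eq_add_one, hn, h.iterate_rot]⟩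
  let := h.distribLattice
  refine ⟨⟨inferInstance, ⟨e, ?_⟩, fun _ _ => rfl, fun _ _ => rfl, fun _ => rfl, n,
    h.iterate_rot⟩, h.inf_sup_left⟩
  intro x y
  rw [← sup_eq_right, ← sup_eq_right]
  exact (Eq.congr_left (h.rot_sup x y).symm).trans e.injective.eq_iff

theorem IsDistributiveRotationalLattice.satisfiesIdentities {A : RotAlgebra.{u}}
    (h : A.IsDistributiveRotationalLattice) {n : ℕ} (hn : ∀ x : A, A.rot^[n] x = x) :
    A.SatisfiesIdentities n := by
  obtain ⟨⟨L, σ, hs, hi, hr, -⟩, hd⟩ := h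
  constructor
  case inf_sup_left => exact hd
  case iterate_rot => exact hn
  all_goals intros; simp only [hs, hi, hr, map_sup, map_inf, sup_inf_self, inf_sup_self]
  · exact sup_comm _ _
  · exact sup_assoc _ _ _
  · exact inf_comm _ _
  · exact inf_assoc _ _ _

theorem IsDistributiveRotationalLattice.exists_satisfiesIdentities {A : RotAlgebra.{u}}
    (h : A.IsDistributiveRotationalLattice) : ∃ n : ℕ+, A.SatisfiesIdentities n := by
  obtain ⟨_, _, _, _, _, n, hn⟩ := h.1
  exact ⟨n, h.satisfiesIdentities hn⟩

theorem setOf_isDistributiveRotationalLattice_and_iterate_eq (n : ℕ+) :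
    {A : RotAlgebra.{u} | A.IsDistributiveRotationalLattice ∧ ∀ x : A, A.rot^[n] x = x} =
      {A | A.SatisfiesIdentities n} :=
  Set.ext fun _ => ⟨fun h => h.1.satisfiesIdentities h.2,
    fun h => ⟨h.isDistributiveRotationalLattice, h.iterate_rot⟩⟩

/-- A variety of distributive rotational lattices has bounded exponent. -/
theorem IsVariety.exists_satisfiesIdentities {W : Set RotAlgebra.{u}} (hW : IsVariety W)
    (h : ∀ A ∈ W, A.IsDistributiveRotationalLattice) :
    ∃ n : ℕ+, ∀ A ∈ W, A.SatisfiesIdentities n := by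
  suffices ∃ n : ℕ+, ∀ A ∈ W, ∀ x : A, A.rot^[n] x = x from
    this.imp fun n hn A hA => (h A hA).satisfiesIdentities (hn A hA)
  by_contra! hcon
  choose A hA x hx using hcon
  -- Multiply one counterexample for each exponent. The product lies in `W`, so it has a single
  -- exponent `n`, which the `n`-th factor contradicts.
  have hmem := hW.pi (fun n : ULift.{u} ℕ+ => A n.down) fun n => hA n.down
  obtain ⟨n, hn⟩ := (h _ hmem).exists_satisfiesIdentities
  refine hx n ?_
  exact (pi_iterate_rot (fun n : ULift.{u} ℕ+ => A n.down) n (fun i => x i.down) ⟨n⟩).symm.trans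
    (congrFun (hn.iterate_rot fun i => x i.down) ⟨n⟩)

/-! ### Cubes -/

/-- The element of the cube given by a set of indices of atoms. -/
def cubeOf {n : ℕ+} (S : Set (ZMod n)) : cube.{u} n := ULift.up S

/-- The set of indices of the atoms below an element of a cube. -/
def atomSet {n : ℕ+} (S : cube.{u} n) : Set (ZMod n) := ULift.down S

@[simp]
theorem atomSet_cubeOf {n : ℕ+} (S : Set (ZMod n)) : atomSet (cubeOf.{u} S) = S := rfl

@[simp]
theorem atomSet_sup {n : ℕ+} (S T : cube.{u} n) :
    atomSet ((cube n).sup S T) = atomSet S ∪ atomSet T := rfl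

@[simp]
theorem atomSet_inf {n : ℕ+} (S T : cube.{u} n) :
    atomSet ((cube n).inf S T) = atomSet S ∩ atomSet T := rfl

@[simp]
theorem mem_atomSet_rot {n : ℕ+} (S : cube.{u} n) (i : ZMod n) :
    i ∈ atomSet ((cube n).rot S) ↔ i - 1 ∈ atomSet S := by
  change i ∈ (fun i => i + 1) '' atomSet S ↔ _
  rw [Set.image_add_right, Set.mem_preimage, sub_eq_add_neg]

theorem mem_atomSet_iterate_rot {n : ℕ+} (k : ℕ) (S : cube.{u} n) (i : ZMod n) :
    i ∈ atomSet ((cube n).rot^[k] S) ↔ i - k ∈ atomSet S := by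
  induction k generalizing i with
  | zero => simp
  | succ k ih =>
    rw [Function.iterate_succ_apply', mem_atomSet_rot, ih]
    push_cast
    rw [sub_sub, add_comm]

theorem atomSet_injective {n : ℕ+} : Function.Injective (atomSet : cube.{u} n → _) :=
  fun _ _ h => ULift.ext _ _ h

theorem cube_ext {n : ℕ+} {S T : cube.{u} n} (h : ∀ i, i ∈ atomSet S ↔ i ∈ atomSet T) :
    S = T :=
  atomSet_injective (Set.ext h)

theorem cube_satisfiesIdentities {n m : ℕ+} (h : n ∣ m) :
    (cube.{u} n).SatisfiesIdentities m where
  sup_comm _ _ := cube_ext fun _ => by simp [or_comm]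
  sup_assoc _ _ _ := cube_ext fun _ => by simp [or_assoc]
  inf_comm _ _ := cube_ext fun _ => by simp [and_comm]
  inf_assoc _ _ _ := cube_ext fun _ => by simp [and_assoc]
  sup_inf_self _ _ := cube_ext fun _ => by simp +contextual
  inf_sup_self _ _ := cube_ext fun _ => by simp +contextual
  inf_sup_left _ _ _ := cube_ext fun _ => by simp [and_or_left]
  rot_sup _ _ := cube_ext fun _ => by simp
  rot_inf _ _ := cube_ext fun _ => by simp
  iterate_rot S := cube_ext fun i => by
    rw [mem_atomSet_iterate_rot, (ZMod.natCast_eq_zero_iff _ _).2 (PNat.dvd_iff.1 h), sub_zero]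

theorem dvd_of_cube_satisfiesIdentities {n m : ℕ+} (h : (cube.{u} n).SatisfiesIdentities m) :
    n ∣ m := by
  -- Rotating the atom `{0}` by `m` gives `{m}`, so `m` vanishes in `ZMod n`.
  have := mem_atomSet_iterate_rot m (cubeOf.{u} {(0 : ZMod n)}) (m : ℕ)
  rw [h.iterate_rot] at this
  simpa [ZMod.natCast_eq_zero_iff, PNat.dvd_iff] using this

instance (n : ℕ+) : Nontrivial (cube.{u} n) :=
  ⟨⟨cubeOf ∅, cubeOf {0}, fun h => Set.singleton_ne_empty _ (congrArg atomSet h).symm⟩⟩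

/-- Preimage along the surjection `ZMod n → ZMod d` embeds the smaller cube in the larger one. -/
theorem cube_mem_of_dvd {W : Set RotAlgebra.{u}} (hW : IsVariety W) {d n : ℕ+} (h : d ∣ n)
    (hn : cube n ∈ W) : cube d ∈ W := by
  have hdn := PNat.dvd_iff.1 h
  let c := ZMod.castHom hdn (ZMod d)
  have hc : Function.Surjective c := ZMod.castHom_surjective hdn
  refine hW.sub (A := cube n) (fun S => cubeOf (c ⁻¹' atomSet S)) ⟨?_, ?_, ?_⟩ ?_ hn
  · exact fun S T => cube_ext fun i => by simp
  · exact fun S T => cube_ext fun i => by simp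
  · exact fun S => cube_ext fun i => by simp
  · exact fun S T hST => atomSet_injective (hc.preimage_injective (congrArg atomSet hST))

/-- Proper congruences of a cube are trivial, since a nontrivial one collapses an atom to the
bottom. -/
theorem cube_isSimple (n : ℕ+) : (cube.{u} n).IsSimple := by
  refine ⟨inferInstance, fun θ hθ => or_iff_not_imp_left.2 fun hne => ?_⟩
  have key : ∃ S T : cube.{u} n, θ S T ∧ ∃ i, i ∈ atomSet S ∧ i ∉ atomSet T := by
    by_contra! hcon
    refine hne (le_bot_iff.1 fun S T h => cube_ext fun i => ?_)
    exact ⟨hcon S T h i, hcon T S (θ.symm' h) i⟩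
  obtain ⟨S, T, hST, i, hiS, hiT⟩ := key
  have hi : θ (cubeOf {i}) (cubeOf ∅) := by
    have h := hθ.inf (θ.refl' (cubeOf {i})) hST
    rwa [show (cube n).inf (cubeOf {i}) S = cubeOf {i} from
        cube_ext fun j => by simp +contextual [hiS],
      show (cube n).inf (cubeOf {i}) T = cubeOf ∅ from
        cube_ext fun j => by simp +contextual [hiT]] at h
  have hk (k : ℕ) : θ (cubeOf {i + k}) (cubeOf ∅) := by
    induction k with
    | zero => simpa using hi
    | succ k ih =>
      have h := hθ.rot ih
      rwa [show (cube n).rot (cubeOf {i + k}) = cubeOf {i + (k + 1 : ℕ)} from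
          cube_ext fun j => by simp [sub_eq_iff_eq_add, add_assoc],
        show (cube n).rot (cubeOf ∅) = cubeOf ∅ from cube_ext fun j => by simp] at h
  have hj (j : ZMod n) : θ (cubeOf {j}) (cubeOf ∅) := by
    have := hk (j - i).val
    rwa [ZMod.natCast_zmod_val, add_sub_cancel] at this
  have hfin (s : Set (ZMod n)) (hs : s.Finite) : θ (cubeOf s) (cubeOf ∅) := by
    induction s, hs using Set.Finite.induction_on with
    | empty => exact θ.refl' _
    | @insert j s _ _ ih =>
      have h := hθ.sup (hj j) ih
      rwa [show (cube n).sup (cubeOf {j}) (cubeOf s) = cubeOf (insert j s) from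
          cube_ext fun k => by simp,
        show (cube n).sup (cubeOf ∅) (cubeOf ∅) = cubeOf ∅ from cube_ext fun j => by simp] at h
  have hall (S : cube.{u} n) : θ S (cubeOf ∅) := hfin (atomSet S) (Set.toFinite _)
  exact top_le_iff.1 fun S T _ => θ.trans' (hall S) (θ.symm' (hall T))

/-! ### Simplicity and subdirect irreducibility -/

/-- The kernel of a homomorphism is a congruence. -/
theorem IsHom.isCongruence_ker {A B : RotAlgebra.{u}} {f : A → B} (hf : IsHom f) :
    A.IsCongruence (Setoid.ker f) where
  sup h₁ h₂ := by simp only [Setoid.ker_def] at *; rw [hf.map_sup, hf.map_sup, h₁, h₂]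
  inf h₁ h₂ := by simp only [Setoid.ker_def] at *; rw [hf.map_inf, hf.map_inf, h₁, h₂]
  rot h := by simp only [Setoid.ker_def] at *; rw [hf.map_rot, hf.map_rot, h]

/-- If no coordinate map had trivial kernel, all the kernels would be full, and the embedding would
identify all points. -/
theorem IsSimple.isSubdirectlyIrreducible {A : RotAlgebra.{u}} (h : A.IsSimple) :
    A.IsSubdirectlyIrreducible := by
  refine ⟨h.1, fun ι B f hf => ?_⟩
  have hom (i : ι) : IsHom (A := A) (B := B i) fun x => f x i := (isHom_pi_apply B i).comp hf.hom
  have key : ∃ i, Setoid.ker (fun x : A => f x i) = ⊥ := by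
    by_contra! hcon
    obtain ⟨x, y, hxy⟩ := h.1
    refine hxy (hf.injective (funext fun i => ?_))
    have := ((h.2 _ (hom i).isCongruence_ker).resolve_left (hcon i)).ge
    exact this (x := x) (y := y) trivial
  obtain ⟨i, hi⟩ := key
  exact ⟨i, hom i, Setoid.injective_iff_ker_bot _ |>.2 hi, hf.surjective i⟩

theorem IsSimple.of_isomorphic {A B : RotAlgebra.{u}} (hB : B.IsSimple) (h : A.Isomorphic B) :
    A.IsSimple := by
  obtain ⟨f, hf, hbij⟩ := h
  let e := Equiv.ofBijective f hbij
  have hes (x y : B) : e.symm (B.sup x y) = A.sup (e.symm x) (e.symm y) :=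
    e.symm_apply_eq.2 (by simp [e, hf.map_sup, Equiv.ofBijective_apply_symm_apply])
  have hei (x y : B) : e.symm (B.inf x y) = A.inf (e.symm x) (e.symm y) :=
    e.symm_apply_eq.2 (by simp [e, hf.map_inf, Equiv.ofBijective_apply_symm_apply])
  have her (x : B) : e.symm (B.rot x) = A.rot (e.symm x) :=
    e.symm_apply_eq.2 (by simp [e, hf.map_rot, Equiv.ofBijective_apply_symm_apply])
  have := hB.1
  refine ⟨e.nontrivial, fun θ hθ => ?_⟩
  have hcomap : B.IsCongruence (θ.comap e.symm) :=
    ⟨fun h₁ h₂ => by simpa [Setoid.comap_rel, hes] using hθ.sup h₁ h₂,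
      fun h₁ h₂ => by simpa [Setoid.comap_rel, hei] using hθ.inf h₁ h₂,
      fun h₁ => by simpa [Setoid.comap_rel, her] using hθ.rot h₁⟩
  refine (hB.2 _ hcomap).imp (fun hb => ?_) (fun ht => ?_)
  · refine le_bot_iff.1 fun x y hxy => e.injective (hb.le (x := e x) (y := e y) ?_)
    simpa [Setoid.comap_rel] using hxy
  · refine top_le_iff.1 fun x y _ => ?_
    simpa [Setoid.comap_rel] using ht.ge (x := e x) (y := e y) trivial

/-! ### Prime filters and their periods -/

/-- The prime ideal theorem, applied to the filter above `x` and the ideal below `y`; the predicate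
is the complement of the prime ideal. -/
theorem exists_prime_separating {α : Type*} [DistribLattice α] {x y : α} (h : ¬ x ≤ y) :
    ∃ p : α → Prop, (∀ a b, p (a ⊔ b) ↔ p a ∨ p b) ∧ (∀ a b, p (a ⊓ b) ↔ p a ∧ p b) ∧
      p x ∧ ¬ p y := by
  obtain ⟨J, hJ, hyJ, hxJ⟩ := DistribLattice.prime_ideal_of_disjoint_filter_ideal
    (F := Order.PFilter.principal x) (I := Order.Ideal.principal y)
    (Set.disjoint_left.2 fun a hxa hay => h (le_trans hxa hay))
  refine ⟨fun a => a ∉ J, fun a b => ?_, fun a b => ?_, ?_, ?_⟩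
  · change a ⊔ b ∉ J ↔ _
    rw [Order.Ideal.sup_mem_iff, not_and_or]
  · change a ⊓ b ∉ J ↔ _
    rw [← not_or, not_iff_not]
    exact ⟨hJ.mem_or_mem, fun h => h.elim (fun h => J.lower inf_le_left h)
      fun h => J.lower inf_le_right h⟩
  · exact Set.disjoint_left.1 hxJ le_rfl
  · exact not_not.2 (hyJ le_rfl)

/-- A family of subsets of a finite type that is closed under binary unions and intersections and
separates points in the strong sense contains all subsets. -/
theorem mem_of_separating {ι : Type*} [Finite ι] [Nonempty ι] {R : Set (Set ι)}
    (hsup : ∀ S ∈ R, ∀ T ∈ R, S ∪ T ∈ R) (hinf : ∀ S ∈ R, ∀ T ∈ R, S ∩ T ∈ R)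
    (hmem : ∀ i, ∃ S ∈ R, i ∈ S) (hnot : ∀ i, ∃ S ∈ R, i ∉ S)
    (hsep : ∀ i j, i ≠ j → ∃ S ∈ R, i ∈ S ∧ j ∉ S) (S : Set ι) : S ∈ R := by
  classical
  have havoid (i : ι) (s : Finset ι) : i ∉ s → ∃ S ∈ R, i ∈ S ∧ ∀ j ∈ s, j ∉ S := by
    induction s using Finset.induction_on with
    | empty => intro; simpa using hmem i
    | insert j s _ ih =>
      intro hi
      obtain ⟨hij, his⟩ : i ≠ j ∧ i ∉ s := by simpa using hi
      obtain ⟨S, hS, hiS, hsS⟩ := ih his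
      obtain ⟨T, hT, hiT, hjT⟩ := hsep i j hij
      refine ⟨S ∩ T, hinf S hS T hT, ⟨hiS, hiT⟩, fun k hk hkST => ?_⟩
      rcases Finset.mem_insert.1 hk with rfl | hk
      exacts [hjT hkST.2, hsS k hk hkST.1]
  have hempty' (s : Finset ι) : ∃ S ∈ R, ∀ j ∈ s, j ∉ S := by
    induction s using Finset.induction_on with
    | empty =>
      obtain ⟨S, hS, -⟩ := hmem (Classical.arbitrary ι)
      exact ⟨S, hS, by simp⟩
    | insert j s _ ih =>
      obtain ⟨S, hS, hsS⟩ := ih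
      obtain ⟨T, hT, hjT⟩ := hnot j
      refine ⟨S ∩ T, hinf S hS T hT, fun k hk hkST => ?_⟩
      rcases Finset.mem_insert.1 hk with rfl | hk
      exacts [hjT hkST.2, hsS k hk hkST.1]
  have := Fintype.ofFinite ι
  have hempty : ∅ ∈ R := by
    obtain ⟨S, hS, h⟩ := hempty' Finset.univ
    rwa [← Set.eq_empty_of_forall_notMem fun j => h j (Finset.mem_univ j)]
  have hsingle (i : ι) : {i} ∈ R := by
    obtain ⟨S, hS, hi, h⟩ := havoid i (Finset.univ.erase i) (by simp)
    convert hS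
    refine (Set.eq_singleton_iff_unique_mem.2 ⟨hi, fun j hj => ?_⟩).symm
    by_contra hji
    exact h j (by simpa using hji) hj
  induction S, S.toFinite using Set.Finite.induction_on with
  | empty => exact hempty
  | @insert j s _ _ ih => exact hsup _ (hsingle j) _ ih

theorem iterate_comp_right_apply {α β : Type*} (g : α → α) (p : α → β) (k : ℕ) (x : α) :
    (fun q : α → β => q ∘ g)^[k] p x = p (g^[k] x) := by
  induction k generalizing p with
  | zero => rfl
  | succ k ih => rw [Function.iterate_succ_apply, ih, Function.comp_apply,
      ← Function.iterate_succ_apply' g]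

/-- The shifts of a predicate along a map of finite order are indexed by `ZMod d`, where
`d` is the period of the predicate; moreover, distinct shifts are incomparable. -/
theorem exists_period {α : Type*} {g : α → α} {n : ℕ+} (hg : ∀ x, g^[n] x = x) (p : α → Prop) :
    ∃ d : ℕ+, (∀ (a b : ℕ) (x), (a : ZMod d) = b → p (g^[a] x) → p (g^[b] x)) ∧
      ∀ a b : ℕ, (∀ x, p (g^[a] x) → p (g^[b] x)) → (a : ZMod d) = b := by
  set T : (α → Prop) → (α → Prop) := fun q => q ∘ g
  have hT : ∀ (k : ℕ) (x : α), T^[k] p x = p (g^[k] x) := iterate_comp_right_apply g p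
  have hper : Function.IsPeriodicPt T n p := funext fun x => by rw [hT, hg]
  refine ⟨⟨Function.minimalPeriod T p, hper.minimalPeriod_pos n.pos⟩, fun a b x hab h => ?_,
    fun a b h => ?_⟩
  · rw [ZMod.natCast_eq_natCast_iff, PNat.mk_coe] at hab
    rw [← hT, ← Function.iterate_mod_minimalPeriod_eq] at h ⊢
    rwa [← hab]
  · have hshift (x : α) (hx : p x) : p (g^[b + (n * a - a)] x) := by
      rw [Function.iterate_add_apply]
      refine h _ ?_
      rw [← Function.iterate_add_apply,
        Nat.add_sub_cancel' (Nat.le_mul_of_pos_left a n.pos), Function.iterate_mul]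
      rwa [Function.iterate_fixed (hg x)]
    set c := b + (n * a - a) with hc
    have hiter (k : ℕ) (x : α) (hx : p x) : p ((g^[c])^[k] x) := by
      induction k with
      | zero => exact hx
      | succ k ih => rw [Function.iterate_succ_apply']; exact hshift _ ih
    -- Iterating `p ≤ p ∘ g^[c]` gives an increasing chain that returns to `p` after `n` steps, so
    -- every inclusion in it is an equality.
    have hfix : Function.IsPeriodicPt T c p := by
      refine funext fun x => propext ?_
      rw [hT]
      refine ⟨fun hx => ?_, hshift x⟩
      have := hiter (n - 1) _ hx
      rw [← Function.iterate_succ_apply, Nat.succ_eq_add_one, Nat.sub_add_cancel n.pos,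
        ← Function.iterate_mul, mul_comm, Function.iterate_mul] at this
      rwa [Function.iterate_fixed (hg x)] at this
    rw [ZMod.natCast_eq_natCast_iff, PNat.mk_coe]
    have hn : Function.minimalPeriod T p ∣ n * a := hper.minimalPeriod_dvd.mul_right a
    have hle : a ≤ n * a := Nat.le_mul_of_pos_left a n.pos
    have h1 : c + a = b + n * a := by omega
    have h2 : c + a ≡ 0 + a [MOD Function.minimalPeriod T p] :=
      ((Nat.modEq_zero_iff_dvd).2 hfix.minimalPeriod_dvd).add_right a
    have h3 : b + n * a ≡ b + 0 [MOD Function.minimalPeriod T p] :=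
      ((Nat.modEq_zero_iff_dvd).2 hn).add_left b
    rw [h1] at h2
    simpa using h2.symm.trans h3

/-! ### Subdirect representation by cubes -/

theorem SatisfiesIdentities.isHom_iterate_rot {A : RotAlgebra.{u}} {n : ℕ}
    (h : A.SatisfiesIdentities n) (k : ℕ) : IsHom A.rot^[k] := by
  induction k with
  | zero => exact ⟨fun _ _ => rfl, fun _ _ => rfl, fun _ => rfl⟩
  | succ k ih => exact ih.comp ⟨h.rot_sup, h.rot_inf, fun _ => rfl⟩

/-- `p` is a homomorphism from the lattice reduct onto the two-element lattice, that is, the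
membership predicate of a proper nonempty prime filter. -/
structure IsPrimePredicate {A : RotAlgebra.{u}} (p : A → Prop) : Prop where
  sup : ∀ x y, p (A.sup x y) ↔ p x ∨ p y
  inf : ∀ x y, p (A.inf x y) ↔ p x ∧ p y
  exists_true : ∃ x, p x
  exists_false : ∃ x, ¬ p x

theorem SatisfiesIdentities.exists_isPrimePredicate {A : RotAlgebra.{u}} {n : ℕ}
    (h : A.SatisfiesIdentities n) {x y : A} (hxy : x ≠ y) :
    ∃ p : A → Prop, IsPrimePredicate p ∧ ¬ (p x ↔ p y) := by
  let := h.distribLattice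
  have hle : ¬ x ≤ y ∨ ¬ y ≤ x := by
    by_contra! hcon
    exact hxy (le_antisymm hcon.1 hcon.2)
  rcases hle with hle | hle <;> obtain ⟨p, hs, hi, h₁, h₂⟩ := exists_prime_separating hle
  · exact ⟨p, ⟨hs, hi, ⟨_, h₁⟩, ⟨_, h₂⟩⟩, by tauto⟩
  · exact ⟨p, ⟨hs, hi, ⟨_, h₁⟩, ⟨_, h₂⟩⟩, by tauto⟩

/-- The orbit of a prime filter under the rotation gives a homomorphism onto a cube. -/
theorem SatisfiesIdentities.exists_surjective_hom_cube {A : RotAlgebra.{u}} {n : ℕ+}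
    (h : A.SatisfiesIdentities n) {p : A → Prop} (hp : IsPrimePredicate p) :
    ∃ (d : ℕ+) (f : A → cube.{u} d), IsHom f ∧ Function.Surjective f ∧
      ∀ x y, f x = f y → (p x ↔ p y) := by
  obtain ⟨d, hcongr, hsep⟩ := exists_period h.iterate_rot p
  -- The minus sign is needed because rotating a set replaces the test at `i` by the test at `i -
  -- 1`. By `hcongr`, the choice of representative `val` is immaterial.
  let f : A → cube.{u} d := fun x => cubeOf {i | p (A.rot^[(-i).val] x)}
  have mem_f (x : A) (i : ZMod d) : i ∈ atomSet (f x) ↔ p (A.rot^[(-i).val] x) := Iff.rfl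
  have hf : IsHom f := by
    refine ⟨fun x y => cube_ext fun i => ?_, fun x y => cube_ext fun i => ?_,
      fun x => cube_ext fun i => ?_⟩
    · rw [mem_f, (h.isHom_iterate_rot _).map_sup, hp.sup]
      rfl
    · rw [mem_f, (h.isHom_iterate_rot _).map_inf, hp.inf]
      rfl
    · rw [mem_f, mem_atomSet_rot, mem_f, ← Function.iterate_succ_apply]
      have : (((-i).val.succ : ℕ) : ZMod d) = ((-(i - 1)).val : ℕ) := by
        rw [Nat.cast_succ, ZMod.natCast_zmod_val, ZMod.natCast_zmod_val]
        ring
      exact ⟨hcongr _ _ x this, hcongr _ _ x this.symm⟩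
  have hshift (x : A) (i : ZMod d) : ∃ y, i ∈ atomSet (f y) ↔ p x := by
    refine ⟨A.rot^[i.val] x, ?_⟩
    rw [mem_f, ← Function.iterate_add_apply]
    have : (((-i).val + i.val : ℕ) : ZMod d) = (0 : ℕ) := by simp
    exact ⟨hcongr _ _ x this, hcongr _ _ x this.symm⟩
  refine ⟨d, f, hf, fun S => ?_, fun x y hxy => ?_⟩
  · have hall := mem_of_separating (R := Set.range fun x => atomSet (f x)) ?_ ?_ ?_ ?_ ?_ (atomSet S)
    · obtain ⟨x, hx⟩ := hall
      exact ⟨x, atomSet_injective hx⟩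
    · rintro _ ⟨x, rfl⟩ _ ⟨y, rfl⟩
      exact ⟨A.sup x y, by simp only [hf.map_sup, atomSet_sup]⟩
    · rintro _ ⟨x, rfl⟩ _ ⟨y, rfl⟩
      exact ⟨A.inf x y, by simp only [hf.map_inf, atomSet_inf]⟩
    · intro i
      obtain ⟨x, hx⟩ := hp.exists_true
      obtain ⟨y, hy⟩ := hshift x i
      exact ⟨_, ⟨y, rfl⟩, hy.2 hx⟩
    · intro i
      obtain ⟨x, hx⟩ := hp.exists_false
      obtain ⟨y, hy⟩ := hshift x i
      exact ⟨_, ⟨y, rfl⟩, fun hi => hx (hy.1 hi)⟩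
    -- Incomparability of distinct shifts is exactly the separation of `i` from `j`.
    · intro i j hij
      by_contra! hcon
      refine hij (neg_injective ?_)
      have := hsep (-i).val (-j).val fun x hx => hcon _ ⟨x, rfl⟩ hx
      rwa [ZMod.natCast_zmod_val, ZMod.natCast_zmod_val] at this
  -- Coordinate `0` is the unshifted predicate `p`.
  · have hxy0 : (0 : ZMod d) ∈ atomSet (f x) ↔ 0 ∈ atomSet (f y) := by rw [hxy]
    simpa [mem_f] using hxy0

/-- Every distributive rotational lattice is a subdirect product of cubes. -/
theorem IsDistributiveRotationalLattice.exists_isSubdirectEmbedding {A : RotAlgebra.{u}}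
    (h : A.IsDistributiveRotationalLattice) :
    ∃ (ι : Type u) (d : ι → ℕ+) (f : A → pi fun i => cube (d i)), IsSubdirectEmbedding f := by
  obtain ⟨n, h⟩ := h.exists_satisfiesIdentities
  choose d f hf hsurj hinj using
    fun p : {p : A → Prop // IsPrimePredicate p} => h.exists_surjective_hom_cube p.2
  refine ⟨_, d, fun x p => f p x, ⟨?_, ?_, ?_⟩, fun x y hxy => ?_, hsurj⟩
  · exact fun x y => funext fun p => (hf p).map_sup x y
  · exact fun x y => funext fun p => (hf p).map_inf x y
  · exact fun x => funext fun p => (hf p).map_rot x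
  · by_contra hne
    obtain ⟨p, hp, hpxy⟩ := h.exists_isPrimePredicate hne
    exact hpxy (hinj ⟨p, hp⟩ x y (congrFun hxy ⟨p, hp⟩))

theorem isDistributiveRotationalLattice_and_isSubdirectlyIrreducible_iff (A : RotAlgebra.{u}) :
    (A.IsDistributiveRotationalLattice ∧ A.IsSubdirectlyIrreducible) ↔
      ∃ n : ℕ+, A.Isomorphic (cube n) := by
  constructor
  · rintro ⟨hA, hsi⟩
    obtain ⟨ι, d, f, hf⟩ := hA.exists_isSubdirectEmbedding
    obtain ⟨i, hi⟩ := hsi.2 ι _ f hf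
    exact ⟨d i, _, hi⟩
  · rintro ⟨n, hn⟩
    refine ⟨?_, ((cube_isSimple n).of_isomorphic hn).isSubdirectlyIrreducible⟩
    obtain ⟨f, hf, hbij⟩ := hn
    exact ((isVariety_satisfiesIdentities n).sub f hf hbij.injective
      (cube_satisfiesIdentities dvd_rfl)).isDistributiveRotationalLattice

/-- A variety of distributive rotational lattices is generated by the cubes it contains. -/
theorem IsVariety.eq_cubeVariety {W : Set RotAlgebra.{u}} (hW : IsVariety W)
    (h : ∀ A ∈ W, A.IsDistributiveRotationalLattice) :
    W = cubeVariety {n | cube n ∈ W} := by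
  refine Set.Subset.antisymm (fun A hA => ?_) (cubeVariety_subset hW fun n hn => hn)
  obtain ⟨ι, d, f, hf⟩ := (h A hA).exists_isSubdirectEmbedding
  have hV := isVariety_generatedVariety (cube '' {n | cube.{u} n ∈ W})
  refine hV.sub f hf.hom hf.injective (hV.pi _ fun i => ?_)
  exact cube_mem_cubeVariety
    (hW.image (fun x => f x i) ((isHom_pi_apply _ i).comp hf.hom) (hf.surjective i) hA)

/-! ### Separating varieties generated by cubes -/

/-- The join of the rotations of `z` by `k` and by the members of `l`. -/
def joinRot (k : ℕ) (l : List ℕ) (A : RotAlgebra.{u}) (z : A) : A :=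
  l.foldr (fun y acc => A.sup (A.rot^[y] z) acc) (A.rot^[k] z)

theorem IsHom.map_joinRot {A B : RotAlgebra.{u}} {f : A → B} (hf : IsHom f) (k : ℕ) (l : List ℕ)
    (z : A) : f (joinRot k l A z) = joinRot k l B (f z) := by
  induction l with
  | nil => exact hf.iterate_rot k z
  | cons y l ih =>
    change f (A.sup (A.rot^[y] z) (joinRot k l A z)) = B.sup (B.rot^[y] (f z)) (joinRot k l B (f z))
    rw [hf.map_sup, hf.iterate_rot, ih]

theorem mem_atomSet_joinRot {n : ℕ+} (k : ℕ) (l : List ℕ) (S : cube.{u} n) (i : ZMod n) :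
    i ∈ atomSet (joinRot k l (cube n) S) ↔ ∃ y ∈ k :: l, i - y ∈ atomSet S := by
  induction l with
  | nil => exact (mem_atomSet_iterate_rot k S i).trans (by simp)
  | cons y l ih =>
    change i ∈ atomSet ((cube n).sup ((cube n).rot^[y] S) (joinRot k l (cube n) S)) ↔ _
    rw [atomSet_sup, Set.mem_union, ih, mem_atomSet_iterate_rot]
    simp only [List.mem_cons, exists_eq_or_imp]
    tauto

/-- The identity `z ≤ ⋁ y ∈ Y, rot^[y] z` separates `cube x` from the cubes of dimension in `Y`. -/
theorem mem_of_cube_mem_cubeVariety {Y : Set ℕ+} (hY : IsFiniteDivisorIdeal Y) {x : ℕ+}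
    (hx : cube.{u} x ∈ cubeVariety Y) : x ∈ Y := by
  rcases Y.eq_empty_or_nonempty with rfl | ⟨k, hk⟩
  -- For empty `Y` the join would be empty, and there is no constant for the bottom; here the
  -- variety is trivial instead.
  · have hsub : Subsingleton (cube.{u} x) := hx _ isVariety_subsingleton (by simp)
    exact (not_subsingleton _ hsub).elim
  let l : List ℕ := hY.1.toFinset.toList.map (fun y : ℕ+ => (y : ℕ))
  have hl {a : ℕ} : a ∈ (k : ℕ) :: l ↔ ∃ y ∈ Y, (y : ℕ) = a := by
    simp only [l, List.mem_cons, List.mem_map, Finset.mem_toList, Set.Finite.mem_toFinset]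
    exact ⟨fun h => h.elim (fun h => ⟨k, hk, h.symm⟩) id, Or.inr⟩
  have hvar : IsVariety {A : RotAlgebra.{u} | ∀ z _ _ : A, A.inf z (joinRot k l A z) = z} :=
    isVariety_setOf_eq (fun f hf x y z => by rw [hf.map_inf, hf.map_joinRot])
      (fun f hf x y z => rfl)
  have hmem := cubeVariety_subset hvar (X := Y) (fun y hy z _ _ => cube_ext fun i => by
    rw [atomSet_inf, Set.mem_inter_iff, and_iff_left_iff_imp, mem_atomSet_joinRot]
    exact fun hi => ⟨y, hl.2 ⟨y, hy, rfl⟩, by simpa using hi⟩) hx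
  -- Evaluate the identity at the atom `{0}`: some rotation by `y ∈ Y` fixes it, so `x ∣ y`.
  have hsing := congrArg atomSet (hmem (cubeOf {0}) (cubeOf ∅) (cubeOf ∅))
  have h0 : (0 : ZMod x) ∈ atomSet (joinRot k l (cube.{u} x) (cubeOf {0})) := by
    have h0 : (0 : ZMod x) ∈ atomSet (cubeOf.{u} ({0} : Set (ZMod x))) := rfl
    rw [← hsing] at h0
    exact h0.2
  obtain ⟨a, ha, ha0⟩ := (mem_atomSet_joinRot ..).1 h0
  obtain ⟨y, hy, rfl⟩ := hl.1 ha
  refine hY.2 y x hy (PNat.dvd_iff.2 ((ZMod.natCast_eq_zero_iff _ _).1 ?_))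
  simpa using ha0

/-- The dimensions of the cubes in a variety of distributive rotational lattices. -/
theorem IsVariety.isFiniteDivisorIdeal {W : Set RotAlgebra.{u}} (hW : IsVariety W)
    (h : ∀ A ∈ W, A.IsDistributiveRotationalLattice) :
    IsFiniteDivisorIdeal {n | cube n ∈ W} := by
  obtain ⟨N, hN⟩ := hW.exists_satisfiesIdentities h
  -- The dimensions all divide the common exponent `N`.
  refine ⟨(Set.finite_Iic N).subset fun n hn => ?_, fun x y hx hyx => cube_mem_of_dvd hW hyx hx⟩
  exact PNat.le_of_dvd (dvd_of_cube_satisfiesIdentities (hN _ hn))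

/-- Finiteness supplies a common exponent, the product of all members of `X` (equal to `1` when `X`
is empty). -/
theorem IsFiniteDivisorIdeal.isDistributiveRotationalLattice {X : Set ℕ+}
    (hX : IsFiniteDivisorIdeal X) {A : RotAlgebra.{u}} (hA : A ∈ cubeVariety X) :
    A.IsDistributiveRotationalLattice := by
  have h := cubeVariety_subset (isVariety_satisfiesIdentities.{u} (∏ x ∈ hX.1.toFinset, x : ℕ+))
    (fun n hn => cube_satisfiesIdentities
      (Finset.dvd_prod_of_mem (fun x => x) (hX.1.mem_toFinset.2 hn))) hA
  exact SatisfiesIdentities.isDistributiveRotationalLattice h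

theorem cubeVariety_subset_cubeVariety_iff {X Y : Set ℕ+} (hY : IsFiniteDivisorIdeal Y) :
    cubeVariety.{u} X ⊆ cubeVariety Y ↔ X ⊆ Y :=
  ⟨fun h _ hx => mem_of_cube_mem_cubeVariety hY (h (cube_mem_cubeVariety hx)),
    fun h => cubeVariety_subset (isVariety_generatedVariety _) fun _ hn =>
      cube_mem_cubeVariety (h hn)⟩

theorem setOf_satisfiesIdentities_eq_cubeVariety (n : ℕ+) :
    {A : RotAlgebra.{u} | A.SatisfiesIdentities n} = cubeVariety {d : ℕ+ | d ∣ n} := by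
  rw [(isVariety_satisfiesIdentities n).eq_cubeVariety
    fun A hA => SatisfiesIdentities.isDistributiveRotationalLattice hA]
  congr 1
  exact Set.ext fun d => ⟨dvd_of_cube_satisfiesIdentities, cube_satisfiesIdentities⟩

end RotAlgebra

theorem theorem1 :
    -- the subdirectly irreducibles are the cubes, up to isomorphism, and the cubes are simple
    ((∀ A : RotAlgebra.{u},
        (A.IsDistributiveRotationalLattice ∧ A.IsSubdirectlyIrreducible) ↔
          ∃ n : ℕ+, A.Isomorphic (RotAlgebra.cube n)) ∧
      ∀ n : ℕ+, (RotAlgebra.cube.{u} n).IsSimple) ∧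
    -- the varieties of distributive rotational lattices
    ((∀ W : Set RotAlgebra.{u},
        (RotAlgebra.IsVariety W ∧ ∀ A ∈ W, A.IsDistributiveRotationalLattice) ↔
          ∃ X : Set ℕ+, RotAlgebra.IsFiniteDivisorIdeal X ∧ W = RotAlgebra.cubeVariety X) ∧
      ∀ X Y : Set ℕ+, RotAlgebra.IsFiniteDivisorIdeal X → RotAlgebra.IsFiniteDivisorIdeal Y →
        (RotAlgebra.cubeVariety.{u} X ⊆ RotAlgebra.cubeVariety.{u} Y ↔ X ⊆ Y)) ∧
    -- the variety given by the identity `rot ^ n = id`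
    (∀ n : ℕ+,
      {A : RotAlgebra.{u} | A.IsDistributiveRotationalLattice ∧ ∀ x : A, A.rot^[n] x = x} =
        RotAlgebra.cubeVariety {d : ℕ+ | d ∣ n}) := by
  refine ⟨⟨RotAlgebra.isDistributiveRotationalLattice_and_isSubdirectlyIrreducible_iff,
    RotAlgebra.cube_isSimple⟩, ⟨fun W => ⟨?_, ?_⟩, fun X Y _ hY =>
      RotAlgebra.cubeVariety_subset_cubeVariety_iff hY⟩, fun n => ?_⟩
  · exact fun ⟨hW, h⟩ => ⟨_, hW.isFiniteDivisorIdeal h, hW.eq_cubeVariety h⟩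
  · rintro ⟨X, hX, rfl⟩
    exact ⟨RotAlgebra.isVariety_generatedVariety _,
      fun A hA => hX.isDistributiveRotationalLattice hA⟩
  · rw [RotAlgebra.setOf_isDistributiveRotationalLattice_and_iterate_eq,
      RotAlgebra.setOf_satisfiesIdentities_eq_cubeVariety]
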